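/- Let $X$ be a geodesic metric space that is hyperbolic in the sense of Gromov, with Gromov boundary $\partial X$ (sequences in $X$ converging to infinity, modulo the equivalence $(u_i\mid v_j)_o\to\infty$, with its usual topology), and let a group $\Gamma$ act on $X$ by isometries. An element $g\in\Gamma$ is loxodromic if the orbit map $\mathbb Z\to X$, $k\mapsto g^k\cdot x$, is a quasi-isometric embedding for some (equivalently, every) $x\in X$; then $\partial_\pm g=(\partial_-g,\partial_+g)\in\partial X\times\partial X-\Delta$ denotes its repeller–attractor pair, where $\Delta$ is the diagonal and $\partial_{+}g=\lim_{k\to+\infty}g^{k}\cdot x$, $\partial_{-}g=\lim_{k\to+\infty}g^{-k}\cdot x$. The group $\Gamma$ acts diagonally on $\partial X\times\partial X-\Delta$ (which has the subspace topology of the product), and the orbit of $\partial_\pm g$ is denoted $\Gamma\cdot\partial_\pm g$, its closure in $\partial X\times\partial X-\Delta$ is denoted $\overline{\Gamma\cdot\partial_\pm g}$. A quasi-axis of $g$ is a continuous quasi-isometric embedding $\ell:\mathbb R\to X$ for which there is $T>0$ with $g\cdot\ell(t)=\ell(t+T)$ for all $t$. Two paths $\gamma:[a,b]\to X$ and $\rho:[c,d]\to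 X$ are $L$-Hausdorff close rel endpoints if $d(\gamma(a),\rho(c))\le L$, $d(\gamma(b),\rho(d))\le L$, and the Hausdorff distance between their images is at most $L$. For $g,h\in\Gamma$ write $g\sim h$ (the Bestvina–Fujiwara relation) if either $g=h$, or $g$ and $h$ are both loxodromic and for some (equivalently, any) quasi-axes $\gamma_g$ of $g$ and $\gamma_h$ of $h$ there exists $L$ such that for every subsegment $\gamma_g[a,b]$ there are a subsegment $\gamma_h[c,d]$ and an element $k\in\Gamma$ such that $k(\gamma_g[a,b])$ is $L$-Hausdorff close rel endpoints to $\gamma_h[c,d]$. An element $g$ is WWPD if it is loxodromic and the orbit $\Gamma\cdot\partial_\pm g$ is a discrete subset of $\partial X\times\partial X-\Delta$. **Lemma.** For loxodromic elements $g,h\in\Gamma$ the following are equivalent: 1. $g\sim h$; 2. $\overline{\Gamma\cdot\partial_\pm g}=\overline{\Gamma\cdot\partial_\pm h}$; 3. $\overline{\Gamma\cdot\partial_\pm g}\cap\overline{\Gamma\cdot\partial_\pm h}\neq\emptyset$. If in addition $g$ is WWPD, then the following condition is also equivalent to these: 4. $\Gamma\cdot\partial_\pm g=\Gamma\cdot\partial_\pm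 h$. -/

import Mathlib

open Filter Topology

noncomputable section

/-! ### Geodesic and hyperbolic metric spaces -/

/-- Every two points are joined by a geodesic: an isometrically embedded closed interval. -/
class IsGeodesicSpace (X : Type*) [MetricSpace X] : Prop where
  exists_geodesic : ∀ x y : X, ∃ γ : ℝ → X, γ 0 = x ∧ γ (dist x y) = y ∧
    ∀ s ∈ Set.Icc (0 : ℝ) (dist x y), ∀ t ∈ Set.Icc (0 : ℝ) (dist x y),
      dist (γ s) (γ t) = |s - t|

/-- The Gromov product `(x | y)_o`. -/
def gromovProduct {X : Type*} [MetricSpace X] (o x y : X) : ℝ :=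
  (dist o x + dist o y - dist x y) / 2

/-- Hyperbolicity in the sense of Gromov. -/
class IsGromovHyperbolic (X : Type*) [MetricSpace X] : Prop where
  exists_delta : ∃ δ : ℝ, ∀ o x y z : X,
    min (gromovProduct o x y) (gromovProduct o y z) - δ ≤ gromovProduct o x z

section GromovProduct

variable {X : Type*} [MetricSpace X]

theorem gromovProduct_comm (o x y : X) : gromovProduct o x y = gromovProduct o y x := by
  unfold gromovProduct; rw [dist_comm x y]; ring

theorem gromovProduct_base (o o' x y : X) :
    gromovProduct o' x y - dist o o' ≤ gromovProduct o x y := by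
  unfold gromovProduct
  linarith [dist_triangle o' o x, dist_triangle o' o y, dist_comm o o']

theorem gromovProduct_move (o x x' y y' : X) :
    gromovProduct o x y - dist x x' - dist y y' ≤ gromovProduct o x' y' := by
  unfold gromovProduct
  linarith [dist_triangle o x' x, dist_triangle o y' y, dist_triangle x' x y',
    dist_triangle x y y', dist_comm x x', dist_comm y y']

theorem gromovProduct_smul {Γ : Type*} [Group Γ] [MulAction Γ X] [IsIsometricSMul Γ X]
    (a : Γ) (o x y : X) : gromovProduct o (a • x) (a • y) = gromovProduct (a⁻¹ • o) x y := by
  unfold gromovProduct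
  rw [dist_smul, ← dist_smul a (a⁻¹ • o) x, ← dist_smul a (a⁻¹ • o) y, smul_inv_smul]

end GromovProduct

/-! ### The Gromov boundary -/

/-- `(u_i | v_j)_o → ∞` as `i, j → ∞` (for one, equivalently for every, base point `o`). -/
def GromovClose {X : Type*} [MetricSpace X] (u v : ℕ → X) : Prop :=
  ∀ o : X, Tendsto (fun p : ℕ × ℕ => gromovProduct o (u p.1) (v p.2)) atTop atTop

section GromovClose

variable {X : Type*} [MetricSpace X]

theorem GromovClose.symm {u v : ℕ → X} (huv : GromovClose u v) : GromovClose v u := by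
  intro o
  have hs : Tendsto (Prod.swap : ℕ × ℕ → ℕ × ℕ) atTop atTop := by
    rw [← prod_atTop_atTop_eq]; exact tendsto_snd.prodMk tendsto_fst
  refine ((huv o).comp hs).congr fun p => ?_
  simp only [Function.comp, Prod.fst_swap, Prod.snd_swap]
  exact gromovProduct_comm _ _ _

theorem GromovClose.trans [IsGromovHyperbolic X] {u v w : ℕ → X} (huv : GromovClose u v)
    (hvw : GromovClose v w) : GromovClose u w := by
  intro o
  obtain ⟨δ, hδ⟩ := IsGromovHyperbolic.exists_delta (X := X)
  rw [tendsto_atTop]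
  intro b
  obtain ⟨p, hp⟩ := eventually_atTop.1 ((tendsto_atTop.1 (huv o)) (b + δ))
  obtain ⟨q, hq⟩ := eventually_atTop.1 ((tendsto_atTop.1 (hvw o)) (b + δ))
  refine eventually_atTop.2 ⟨(p.1, q.2), fun r hr => ?_⟩
  have h1 := hp (r.1, max p.2 q.1) ⟨hr.1, le_max_left _ _⟩
  have h2 := hq (max p.2 q.1, r.2) ⟨le_max_right _ _, hr.2⟩
  have h3 := hδ o (u r.1) (v (max p.2 q.1)) (w r.2)
  have h4 := le_min h1 h2
  simp only at h4
  linarith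

theorem GromovClose.of_base {u v : ℕ → X} (o : X)
    (h : Tendsto (fun p : ℕ × ℕ => gromovProduct o (u p.1) (v p.2)) atTop atTop) :
    GromovClose u v := by
  intro o'
  refine tendsto_atTop_mono (fun p => ?_) (tendsto_atTop_add_const_right atTop (-dist o' o) h)
  linarith [gromovProduct_base o' o (u p.1) (v p.2)]

theorem GromovClose.of_dist_le {u v u' v' : ℕ → X} (h : GromovClose u v) (C : ℝ)
    (hu : ∀ n, dist (u n) (u' n) ≤ C) (hv : ∀ n, dist (v n) (v' n) ≤ C) :
    GromovClose u' v' := by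
  intro o
  refine tendsto_atTop_mono (fun p => ?_)
    (tendsto_atTop_add_const_right atTop (-(C + C)) (h o))
  linarith [gromovProduct_move o (u p.1) (u' p.1) (v p.2) (v' p.2), hu p.1, hv p.2]

theorem GromovClose.smul {Γ : Type*} [Group Γ] [MulAction Γ X] [IsIsometricSMul Γ X]
    {u v : ℕ → X} (h : GromovClose u v) (a : Γ) :
    GromovClose (fun n => a • u n) (fun n => a • v n) := by
  intro o
  simp only [gromovProduct_smul]
  exact h _

end GromovClose

/-- Sequences in `X` that converge to infinity. -/
def GromovSequence (X : Type*) [MetricSpace X] : Type _ := {u : ℕ → X // GromovClose u u}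

instance gromovSetoid (X : Type*) [MetricSpace X] [IsGromovHyperbolic X] :
    Setoid (GromovSequence X) where
  r u v := GromovClose u.1 v.1
  iseqv := ⟨fun u => u.2, fun h => h.symm, fun h h' => h.trans h'⟩

/-- The Gromov boundary `∂X`: sequences converging to infinity, up to the equivalence
`(u_i | v_j) → ∞`. -/
def GromovBoundary (X : Type*) [MetricSpace X] [IsGromovHyperbolic X] : Type _ :=
  Quotient (gromovSetoid X)

namespace GromovBoundary

variable {X : Type*} [MetricSpace X] [IsGromovHyperbolic X]

/-- The boundary point represented by a sequence converging to infinity. -/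
def mk (u : ℕ → X) (hu : GromovClose u u) : GromovBoundary X :=
  Quotient.mk (gromovSetoid X) ⟨u, hu⟩

theorem mk_eq_mk {u v : ℕ → X} {hu : GromovClose u u} {hv : GromovClose v v} :
    mk u hu = mk v hv ↔ GromovClose u v :=
  Quotient.eq (r := gromovSetoid X)

/-- The basic neighbourhood of `ξ`: the points `η` such that, for some representatives,
`(u_i | v_j)_o ≥ r` for all large `i, j`. -/
def basicNhd (o : X) (r : ℝ) (ξ : GromovBoundary X) : Set (GromovBoundary X) :=
  {η | ∃ (u v : ℕ → X) (hu : GromovClose u u) (hv : GromovClose v v),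
    mk u hu = ξ ∧ mk v hv = η ∧
      ∀ᶠ p : ℕ × ℕ in atTop, r ≤ gromovProduct o (u p.1) (v p.2)}

theorem basicNhd_anti (o : X) {r s : ℝ} (hrs : r ≤ s) (ξ : GromovBoundary X) :
    basicNhd o s ξ ⊆ basicNhd o r ξ := by
  rintro η ⟨u, v, hu, hv, h1, h2, h3⟩
  exact ⟨u, v, hu, hv, h1, h2, h3.mono fun p hp => hrs.trans hp⟩

/-- The topology of the Gromov boundary. -/
instance : TopologicalSpace (GromovBoundary X) where
  IsOpen U := ∀ ξ ∈ U, ∀ o : X, ∃ r : ℝ, basicNhd o r ξ ⊆ U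
  isOpen_univ := fun _ _ _ => ⟨0, Set.subset_univ _⟩
  isOpen_inter := by
    intro U V hU hV ξ hξ o
    obtain ⟨r, hr⟩ := hU ξ hξ.1 o
    obtain ⟨s, hs⟩ := hV ξ hξ.2 o
    exact ⟨max r s, Set.subset_inter ((basicNhd_anti o (le_max_left r s) ξ).trans hr)
      ((basicNhd_anti o (le_max_right r s) ξ).trans hs)⟩
  isOpen_sUnion := by
    intro S hS ξ hξ o
    obtain ⟨U, hU, hξU⟩ := hξ
    obtain ⟨r, hr⟩ := hS U hU ξ hξU o
    exact ⟨r, hr.trans (Set.subset_sUnion_of_mem hU)⟩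

variable {Γ : Type*} [Group Γ] [MulAction Γ X] [IsIsometricSMul Γ X]

/-- The action on the boundary induced by an isometric action. -/
instance : MulAction Γ (GromovBoundary X) where
  smul a := Quotient.map (fun u => ⟨fun n => a • u.1 n, u.2.smul a⟩)
    (fun _ _ huv => GromovClose.smul huv a)
  one_smul := by
    rintro ⟨u⟩
    refine Quotient.sound (s := gromovSetoid X) ?_
    change GromovClose (fun n => (1 : Γ) • u.1 n) u.1
    simpa only [one_smul] using u.2
  mul_smul := by
    rintro a b ⟨u⟩
    refine Quotient.sound (s := gromovSetoid X) ?_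
    change GromovClose (fun n => (a * b) • u.1 n) (fun n => a • b • u.1 n)
    simpa only [mul_smul] using (u.2.smul b).smul a

theorem smul_mk (a : Γ) (u : ℕ → X) (hu : GromovClose u u) :
    a • mk u hu = mk (fun n => a • u n) (hu.smul a) := rfl

end GromovBoundary

/-- The space `∂X × ∂X - Δ` of ordered pairs of distinct boundary points, with the subspace
topology of the product topology. -/
abbrev BoundaryPair (X : Type*) [MetricSpace X] [IsGromovHyperbolic X] : Type _ :=
  {p : GromovBoundary X × GromovBoundary X // p.1 ≠ p.2}

/-- The diagonal action on `∂X × ∂X - Δ`. -/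
instance BoundaryPair.instMulAction {Γ X : Type*} [Group Γ] [MetricSpace X]
    [IsGromovHyperbolic X] [MulAction Γ X] [IsIsometricSMul Γ X] :
    MulAction Γ (BoundaryPair X) where
  smul a p := ⟨(a • p.1.1, a • p.1.2), fun h => p.2 (smul_left_cancel a h)⟩
  one_smul p := Subtype.ext (Prod.ext (one_smul Γ p.1.1) (one_smul Γ p.1.2))
  mul_smul a b p := Subtype.ext (Prod.ext (mul_smul a b p.1.1) (mul_smul a b p.1.2))

/-! ### Quasi-isometric embeddings and loxodromic elements -/

/-- Quasi-isometric embeddings between metric spaces. -/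
def IsQIEmbedding {A X : Type*} [MetricSpace A] [MetricSpace X] (f : A → X) : Prop :=
  ∃ K C : ℝ, 1 ≤ K ∧ 0 ≤ C ∧ ∀ s t : A,
    dist s t / K - C ≤ dist (f s) (f t) ∧ dist (f s) (f t) ≤ K * dist s t + C

/-- `g` is loxodromic: some orbit map `ℤ → X`, `k ↦ g ^ k • x`, is a quasi-isometric embedding
(equivalently, `X` is nonempty and every such orbit map is one). -/
def IsLoxodromic {Γ : Type*} (X : Type*) [Group Γ] [MetricSpace X] [MulAction Γ X]
    (g : Γ) : Prop :=
  ∃ x : X, IsQIEmbedding (fun k : ℤ => g ^ k • x)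

namespace IsLoxodromic

variable {Γ X : Type*} [Group Γ] [MetricSpace X] [MulAction Γ X]

theorem inv {g : Γ} (hg : IsLoxodromic X g) : IsLoxodromic X g⁻¹ := by
  obtain ⟨x, K, C, hK, hC, h⟩ := hg
  refine ⟨x, K, C, hK, hC, fun s t => ?_⟩
  have := h (-s) (-t)
  simpa only [inv_zpow', dist_neg_neg] using this

/-- Linear growth of the displacement. -/
theorem linear_growth {g : Γ} (hg : IsLoxodromic X g) :
    ∃ (x : X) (K C : ℝ), 1 ≤ K ∧ 0 ≤ C ∧ ∀ n : ℕ, (n : ℝ) / K - C ≤ dist x (g ^ n • x) := by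
  obtain ⟨x, K, C, hK, hC, h⟩ := hg
  refine ⟨x, K, C, hK, hC, fun n => ?_⟩
  have := (h 0 n).1
  simpa [Int.dist_eq] using this

theorem four_point {δ : ℝ} (hδ : ∀ o x y z : X,
    min (gromovProduct o x y) (gromovProduct o y z) - δ ≤ gromovProduct o x z) (x y z w : X) :
    dist x z + dist y w ≤ max (dist x y + dist z w) (dist x w + dist y z) + 2 * δ := by
  have h := hδ w x y z
  simp only [gromovProduct] at h
  rcases le_total ((dist w x + dist w y - dist x y) / 2)
      ((dist w y + dist w z - dist y z) / 2) with h2 | h2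
  all_goals
    first
    | rw [min_eq_left h2] at h
    | rw [min_eq_right h2] at h
  all_goals
    have h3 := le_max_left (dist x y + dist z w) (dist x w + dist y z)
    have h4 := le_max_right (dist x y + dist z w) (dist x w + dist y z)
    linarith [dist_comm w x, dist_comm w y, dist_comm w z]

/-- Some power of a loxodromic element moves points so far that the orbit of this power is
locally, hence globally, monotone. -/
theorem exists_step [IsGromovHyperbolic X] {g : Γ} (hg : IsLoxodromic X g) :
    ∃ (x : X) (δ : ℝ) (k : ℕ), 0 ≤ δ ∧ 0 < k ∧
      (∀ o x y z : X,
        min (gromovProduct o x y) (gromovProduct o y z) - δ ≤ gromovProduct o x z) ∧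
      dist x (g ^ k • x) + 3 * δ < dist x (g ^ (2 * k) • x) ∧
      Tendsto (fun n : ℕ => dist x (g ^ n • x)) atTop atTop := by
  obtain ⟨x, K, C, hK, hC, h⟩ := hg.linear_growth
  obtain ⟨δ, hδ⟩ := IsGromovHyperbolic.exists_delta (X := X)
  have hδ0 : 0 ≤ δ := by
    have := hδ x x x x
    simp only [gromovProduct, dist_self, min_self] at this
    linarith
  have hK0 : 0 < K := by linarith
  have htend : Tendsto (fun n : ℕ => dist x (g ^ n • x)) atTop atTop := by
    refine tendsto_atTop_mono h ?_
    exact tendsto_atTop_add_const_right atTop (-C)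
      (tendsto_natCast_atTop_atTop.atTop_div_const hK0)
  by_cases hk : ∃ k : ℕ, 0 < k ∧ dist x (g ^ k • x) + 3 * δ < dist x (g ^ (2 * k) • x)
  · obtain ⟨k, hk0, hk⟩ := hk
    exact ⟨x, δ, k, hδ0, hk0, hδ, hk, htend⟩
  · exfalso
    push Not at hk
    have hup : ∀ j : ℕ, dist x (g ^ (2 ^ j) • x) ≤ dist x (g • x) + 3 * δ * j := by
      intro j
      induction j with
      | zero => simp
      | succ j ih =>
        have := hk (2 ^ j) (by positivity)
        rw [pow_succ, mul_comm (2 ^ j) 2]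
        push_cast
        linarith
    set A := dist x (g • x)
    have hA : 0 ≤ A := dist_nonneg
    obtain ⟨i, hi⟩ := exists_nat_gt (K * (C + A + 6 * δ))
    have hi0 : 0 < (i : ℝ) := lt_of_le_of_lt (by positivity) hi
    have hi1 : (1 : ℝ) ≤ i := by exact_mod_cast hi0
    have h1 := hup (2 * i)
    have h2 := h (2 ^ (2 * i))
    have h3 : (i : ℝ) * i ≤ ((2 ^ (2 * i) : ℕ) : ℝ) := by
      have : i < 2 ^ i := Nat.lt_two_pow_self
      have h4 : i * i ≤ 2 ^ (2 * i) := by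
        rw [two_mul, pow_add]; exact Nat.mul_le_mul this.le this.le
      exact_mod_cast h4
    have h5 : ((2 ^ (2 * i) : ℕ) : ℝ) ≤ K * (C + A + 6 * δ * i) := by
      have h6 : ((2 ^ (2 * i) : ℕ) : ℝ) / K ≤ C + A + 6 * δ * i := by
        push_cast at h1 h2 ⊢
        linarith
      rw [div_le_iff₀ hK0] at h6
      linarith
    have h7 : K * (C + A + 6 * δ * i) ≤ K * (C + A + 6 * δ) * i := by
      have : C + A + 6 * δ * i ≤ (C + A + 6 * δ) * i := by nlinarith
      nlinarith
    nlinarith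

variable [IsIsometricSMul Γ X]

theorem dist_pow (g : Γ) (x : X) (m n : ℕ) :
    dist (g ^ m • x) (g ^ (m + n) • x) = dist x (g ^ n • x) := by
  rw [pow_add, mul_smul, dist_smul]

theorem step_aux [IsGromovHyperbolic X] {g : Γ} {x : X} {δ : ℝ} {k : ℕ} (hδ0 : 0 ≤ δ)
    (hδ : ∀ o x y z : X,
        min (gromovProduct o x y) (gromovProduct o y z) - δ ≤ gromovProduct o x z)
    (hk : dist x (g ^ k • x) + 3 * δ < dist x (g ^ (2 * k) • x)) (i : ℕ) :
    dist x (g ^ (i * k) • x) ≤ dist x (g ^ ((i + 1) * k) • x) ∧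
    dist x (g ^ ((i + 1) * k) • x) + (dist x (g ^ (2 * k) • x) - dist x (g ^ k • x) - 2 * δ) ≤
      dist x (g ^ ((i + 2) * k) • x) := by
  have key : ∀ i : ℕ, dist x (g ^ (i * k) • x) ≤ dist x (g ^ ((i + 1) * k) • x) →
    dist x (g ^ ((i + 1) * k) • x) + (dist x (g ^ (2 * k) • x) - dist x (g ^ k • x) - 2 * δ) ≤
      dist x (g ^ ((i + 2) * k) • x) := by
    intro i hi
    have h := four_point hδ x (g ^ (i * k) • x) (g ^ ((i + 1) * k) • x) (g ^ ((i + 2) * k) • x)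
    have e1 : dist (g ^ (i * k) • x) (g ^ ((i + 2) * k) • x) = dist x (g ^ (2 * k) • x) := by
      rw [add_mul, dist_pow]
    have e2 : dist (g ^ (i * k) • x) (g ^ ((i + 1) * k) • x) = dist x (g ^ k • x) := by
      rw [add_mul, one_mul, dist_pow]
    have e3 : dist (g ^ ((i + 1) * k) • x) (g ^ ((i + 2) * k) • x) = dist x (g ^ k • x) := by
      rw [show (i + 2) * k = (i + 1) * k + k by ring, dist_pow]
    rw [e1, e2, e3] at h
    rcases max_choice (dist x (g ^ (i * k) • x) + dist x (g ^ k • x))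
      (dist x (g ^ ((i + 2) * k) • x) + dist x (g ^ k • x)) with h1 | h1 <;>
    · rw [h1] at h
      linarith
  have mono : ∀ i : ℕ, dist x (g ^ (i * k) • x) ≤ dist x (g ^ ((i + 1) * k) • x) := by
    intro i
    induction i with
    | zero => simp
    | succ i ih => linarith [key i ih]
  exact ⟨mono i, key i (mono i)⟩

/-- Positive orbits of a loxodromic element converge to infinity. -/
theorem gromovClose_orbit [IsGromovHyperbolic X] {g : Γ} (hg : IsLoxodromic X g) (y : X) :
    GromovClose (fun n : ℕ => g ^ n • y) (fun n : ℕ => g ^ n • y) := by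
  obtain ⟨x, δ, k, hδ0, hk0, hδ, hk, htend⟩ := hg.exists_step
  suffices hx : GromovClose (fun n : ℕ => g ^ n • x) (fun n : ℕ => g ^ n • x) from
    hx.of_dist_le (dist x y) (fun n => (dist_smul _ _ _).le) (fun n => (dist_smul _ _ _).le)
  have mono : Monotone fun i : ℕ => dist x (g ^ (i * k) • x) :=
    monotone_nat_of_le_succ fun i => (step_aux hδ0 hδ hk i).1
  set A : ℝ := ∑ r ∈ Finset.range k, dist x (g ^ r • x) with hA
  have hclose : ∀ n : ℕ, |dist x (g ^ n • x) - dist x (g ^ (n / k * k) • x)| ≤ A := by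
    intro n
    have h1 : dist (g ^ (n / k * k) • x) (g ^ n • x) ≤ A := by
      have : g ^ n • x = g ^ (n / k * k + n % k) • x := by rw [Nat.div_add_mod']
      rw [this, dist_pow]
      exact Finset.single_le_sum (f := fun r => dist x (g ^ r • x)) (fun _ _ => dist_nonneg)
        (Finset.mem_range.2 (Nat.mod_lt n hk0))
    rw [abs_le]
    constructor <;>
    linarith [dist_triangle x (g ^ n • x) (g ^ (n / k * k) • x),
      dist_triangle x (g ^ (n / k * k) • x) (g ^ n • x),
      dist_comm (g ^ (n / k * k) • x) (g ^ n • x)]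
  have hmono : ∀ p q : ℕ, p ≤ q → dist x (g ^ p • x) ≤ dist x (g ^ q • x) + 2 * A := by
    intro p q hpq
    have h1 := (abs_le.1 (hclose p)).2
    have h2 := (abs_le.1 (hclose q)).1
    have h3 : dist x (g ^ (p / k * k) • x) ≤ dist x (g ^ (q / k * k) • x) :=
      mono (Nat.div_le_div_right hpq)
    linarith
  have hprod : ∀ i j : ℕ, i ≤ j →
      dist x (g ^ i • x) / 2 - A ≤ gromovProduct x (g ^ i • x) (g ^ j • x) := by
    intro i j hij
    obtain ⟨p, rfl⟩ := Nat.exists_eq_add_of_le hij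
    have := hmono p (i + p) (Nat.le_add_left _ _)
    unfold gromovProduct
    rw [dist_pow]
    linarith
  refine GromovClose.of_base x (tendsto_atTop.2 fun b => ?_)
  obtain ⟨N, hN⟩ := eventually_atTop.1 (tendsto_atTop.1 htend (2 * (b + A)))
  refine eventually_atTop.2 ⟨(N, N), fun p hp => ?_⟩
  rcases le_total p.1 p.2 with h | h
  · linarith [hprod p.1 p.2 h, hN p.1 hp.1]
  · rw [gromovProduct_comm]
    linarith [hprod p.2 p.1 h, hN p.2 hp.2]

variable [IsGromovHyperbolic X]

/-- The attracting boundary point `∂₊ g`: the limit of the orbit `n ↦ g ^ n • x` as `n → +∞`. -/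
def attractingPoint {g : Γ} (hg : IsLoxodromic X g) : GromovBoundary X :=
  GromovBoundary.mk (fun n : ℕ => g ^ n • hg.choose) (hg.gromovClose_orbit _)

/-- The attracting point does not depend on the choice of the point whose orbit is taken. -/
theorem attractingPoint_eq {g : Γ} (hg : IsLoxodromic X g) (x : X) :
    hg.attractingPoint = GromovBoundary.mk (fun n : ℕ => g ^ n • x) (hg.gromovClose_orbit x) :=
  GromovBoundary.mk_eq_mk.2 ((hg.gromovClose_orbit hg.choose).of_dist_le
    (dist hg.choose x) (fun n => by simp) (fun n => (dist_smul _ _ _).le))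

/-- The repelling boundary point `∂₋ g`: the limit of the orbit `n ↦ g ^ (-n) • x` as
`n → +∞`. -/
def repellingPoint {g : Γ} (hg : IsLoxodromic X g) : GromovBoundary X :=
  hg.inv.attractingPoint

theorem repellingPoint_ne_attractingPoint {g : Γ} (hg : IsLoxodromic X g) :
    hg.repellingPoint ≠ hg.attractingPoint := by
  obtain ⟨x, δ, k, hδ0, hk0, hδ, hk, htend⟩ := hg.exists_step
  rw [repellingPoint, hg.inv.attractingPoint_eq x, hg.attractingPoint_eq x, Ne,
    GromovBoundary.mk_eq_mk]
  intro hclose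
  obtain ⟨p, hp⟩ := eventually_atTop.1
    (tendsto_atTop.1 (hclose x) (dist x (g ^ (2 * k) • x) / 2))
  set m := p.1 + p.2 + 1
  have hm : m ≤ (m + 1) * k := by nlinarith
  have h1 := hp ((m + 1) * k, (m + 1) * k) ⟨by simp only [m] at hm ⊢; omega,
    by simp only [m] at hm ⊢; omega⟩
  simp only at h1
  have h2 := hδ x (g⁻¹ ^ ((m + 1) * k) • x) (g ^ ((m + 1) * k) • x) (g ^ k • x)
  have ea : dist x (g⁻¹ ^ ((m + 1) * k) • x) = dist x (g ^ ((m + 1) * k) • x) := by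
    rw [← dist_smul (g ^ ((m + 1) * k)) x (g⁻¹ ^ ((m + 1) * k) • x), inv_pow, smul_inv_smul,
      dist_comm]
  have eb : dist (g⁻¹ ^ ((m + 1) * k) • x) (g ^ k • x) = dist x (g ^ ((m + 2) * k) • x) := by
    rw [← dist_smul (g ^ ((m + 1) * k)) (g⁻¹ ^ ((m + 1) * k) • x), inv_pow, smul_inv_smul,
      smul_smul, ← pow_add]
    congr 3
    ring
  have ec : dist (g ^ ((m + 1) * k) • x) (g ^ k • x) = dist x (g ^ (m * k) • x) := by
    rw [dist_comm, show (m + 1) * k = k + m * k by ring, dist_pow]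
  have h3 : gromovProduct x (g⁻¹ ^ ((m + 1) * k) • x) (g ^ k • x) =
      (dist x (g ^ ((m + 1) * k) • x) + dist x (g ^ k • x) -
        dist x (g ^ ((m + 2) * k) • x)) / 2 := by
    unfold gromovProduct; rw [ea, eb]
  have h4 : gromovProduct x (g ^ ((m + 1) * k) • x) (g ^ k • x) =
      (dist x (g ^ ((m + 1) * k) • x) + dist x (g ^ k • x) -
        dist x (g ^ (m * k) • x)) / 2 := by
    unfold gromovProduct; rw [ec]
  rw [h3, h4] at h2
  have s1 := (step_aux hδ0 hδ hk m).2
  have s2 : dist x (g ^ (m * k) • x) +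
      (dist x (g ^ (2 * k) • x) - dist x (g ^ k • x) - 2 * δ) ≤
        dist x (g ^ ((m + 1) * k) • x) := (step_aux hδ0 hδ hk (p.1 + p.2)).2
  have h5 : dist x (g ^ (2 * k) • x) / 2 - δ ≤
      min (gromovProduct x (g⁻¹ ^ ((m + 1) * k) • x) (g ^ ((m + 1) * k) • x))
        ((dist x (g ^ ((m + 1) * k) • x) + dist x (g ^ k • x) -
          dist x (g ^ (m * k) • x)) / 2) :=
    le_min (by linarith) (by linarith)
  linarith

/-- The ordered pair `∂± g = (∂₋ g, ∂₊ g)`. -/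
def endpointPair {g : Γ} (hg : IsLoxodromic X g) : BoundaryPair X :=
  ⟨(hg.repellingPoint, hg.attractingPoint), hg.repellingPoint_ne_attractingPoint⟩

end IsLoxodromic

/-! ### The Bestvina–Fujiwara relation and WWPD elements -/

/-- `ℓ` is a quasi-axis of `g`. -/
def IsQuasiAxis {Γ X : Type*} [Group Γ] [MetricSpace X] [MulAction Γ X]
    (g : Γ) (ℓ : ℝ → X) : Prop :=
  Continuous ℓ ∧ IsQIEmbedding ℓ ∧ ∃ T : ℝ, 0 < T ∧ ∀ t : ℝ, g • ℓ t = ℓ (t + T)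

/-- The paths `γ` restricted to `[a, b]` and `ρ` restricted to `[c, d]` are `L`-Hausdorff close
rel endpoints. -/
def HausdorffCloseRelEndpoints {X : Type*} [MetricSpace X] (L : ℝ)
    (γ : ℝ → X) (a b : ℝ) (ρ : ℝ → X) (c d : ℝ) : Prop :=
  dist (γ a) (ρ c) ≤ L ∧ dist (γ b) (ρ d) ≤ L ∧
    Metric.hausdorffDist (γ '' Set.Icc a b) (ρ '' Set.Icc c d) ≤ L

/-- The relation `g ∼ h` of Bestvina and Fujiwara. Any two quasi-axes of the same element have
parametrizations at bounded distance, so 'some quasi-axes' may be replaced by 'any quasi-axes'. -/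
def BestvinaFujiwaraEquiv {Γ : Type*} (X : Type*) [Group Γ] [MetricSpace X] [MulAction Γ X]
    (g h : Γ) : Prop :=
  g = h ∨ (IsLoxodromic X g ∧ IsLoxodromic X h ∧
    ∃ γg γh : ℝ → X, IsQuasiAxis g γg ∧ IsQuasiAxis h γh ∧
      ∃ L : ℝ, ∀ a b : ℝ, a ≤ b → ∃ (c d : ℝ) (k : Γ), c ≤ d ∧
        HausdorffCloseRelEndpoints L (fun t => k • γg t) a b γh c d)

/-- `g` is a WWPD element: it is loxodromic and the orbit of its endpoint pair `∂± g` in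
`∂X × ∂X - Δ` is a discrete subset. -/
def IsWWPD {Γ : Type*} (X : Type*) [Group Γ] [MetricSpace X] [IsGromovHyperbolic X]
    [MulAction Γ X] [IsIsometricSMul Γ X] (g : Γ) : Prop :=
  ∃ hg : IsLoxodromic X g, IsDiscrete (MulAction.orbit Γ hg.endpointPair)

end

/-! A quasi-axis of a loxodromic element is quasi-ruled: the Gromov product of two of its points,
based at a point between them, is bounded. This follows from `repellingPoint ≠ attractingPoint`
alone and takes the place of the Morse lemma: fellow travelling becomes bookkeeping with Gromov
products (`QuasiRuled.exists_fellow_traveler`).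

(1) implies that `∂± g` lies in the closure of the orbit of `∂± h`: apply the relation to longer and
longer segments centred at one point of the axis of `g`. Translates of the axis of `h` then follow
the axis of `g` ever further both ways, so their ends converge to `∂± g`
(`endpointPair_mem_closure`).

(3) implies (1): a common point of the closures gives translates of the two axes whose ends nearly
agree, seen from a point at bounded distance from the translated axis of `g`. Powers of `g` slide
any prescribed segment into the region of agreement, where it fellow travels with a constant
independent of the segment (`bestvinaFujiwaraEquiv_of_nonempty`).

The second implication also shows that `∼` is symmetric, which turns membership in a closure into
equality of closures. In a T1 space a discrete orbit is determined by its closure, which gives (4).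
-/

/-! ### Gromov products -/

/-- `δ` is a nonnegative hyperbolicity constant of `X`. -/
def IsHyperbolicityConst (X : Type*) [MetricSpace X] (δ : ℝ) : Prop :=
  0 ≤ δ ∧ ∀ o x y z : X,
    min (gromovProduct o x y) (gromovProduct o y z) - δ ≤ gromovProduct o x z

theorem exists_isHyperbolicityConst (X : Type*) [MetricSpace X] [IsGromovHyperbolic X] :
    ∃ δ : ℝ, IsHyperbolicityConst X δ := by
  obtain ⟨δ, hδ⟩ := IsGromovHyperbolic.exists_delta (X := X)
  exact ⟨max δ 0, le_max_right _ _, fun o x y z => by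
    linarith [hδ o x y z, le_max_left δ 0]⟩

section Products

variable {X : Type*} [MetricSpace X]

theorem IsHyperbolicityConst.le_trans {δ : ℝ} (hδ : IsHyperbolicityConst X δ) {o x y z : X}
    {r : ℝ} (h1 : r ≤ gromovProduct o x y) (h2 : r ≤ gromovProduct o y z) :
    r - δ ≤ gromovProduct o x z := by
  linarith [hδ.2 o x y z, le_min h1 h2]

/-- Contrapositive of hyperbolicity: in an upper bound, `z` may be replaced by a point `y` lying in
nearly the same direction, at the cost of `δ`. -/
theorem IsHyperbolicityConst.le_of_lt {δ : ℝ} (hδ : IsHyperbolicityConst X δ) {o x y z : X}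
    {D : ℝ} (h1 : gromovProduct o x z ≤ D) (h2 : D + δ < gromovProduct o y z) :
    gromovProduct o x y ≤ D + δ := by
  by_contra! h3
  have := hδ.2 o x y z
  have := lt_min h3 h2
  linarith

theorem gromovProduct_le_dist_left (o x y : X) : gromovProduct o x y ≤ dist o x := by
  unfold gromovProduct
  linarith [dist_triangle o x y]

theorem gromovProduct_le_dist_right (o x y : X) : gromovProduct o x y ≤ dist o y := by
  rw [gromovProduct_comm]; exact gromovProduct_le_dist_left o y x

theorem gromovProduct_add_gromovProduct (x y z : X) :
    gromovProduct y x z + gromovProduct z x y = dist y z := by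
  unfold gromovProduct
  linarith [dist_comm z y, dist_comm y x, dist_comm z x]

theorem gromovProduct_le_base (o o' x y : X) :
    gromovProduct o x y ≤ gromovProduct o' x y + dist o o' := by
  linarith [gromovProduct_base o' o x y, dist_comm o o']

theorem gromovProduct_le_move (o x x' y y' : X) :
    gromovProduct o x y ≤ gromovProduct o x' y' + dist x x' + dist y y' := by
  linarith [gromovProduct_move o x x' y y']

theorem gromovProduct_smul_smul_smul {Γ : Type*} [Group Γ] [MulAction Γ X]
    [IsIsometricSMul Γ X] (a : Γ) (o x y : X) :
    gromovProduct (a • o) (a • x) (a • y) = gromovProduct o x y := by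
  rw [gromovProduct_smul, inv_smul_smul]

/-- If two broken paths `e, b, s` and `f, d, t` are almost geodesic, start near `o`, and have
`b` near `d`, then they point in the same direction as seen from `o`. -/
theorem IsHyperbolicityConst.le_gromovProduct_of_close {δ : ℝ} (hδ : IsHyperbolicityConst X δ)
    {C L : ℝ} {o e b s f d t : X} (hes : gromovProduct b e s ≤ C)
    (hft : gromovProduct d f t ≤ C) (he : dist o e ≤ L) (hf : dist o f ≤ L)
    (hbd : dist b d ≤ L) : dist o b - 4 * L - C - δ ≤ gromovProduct o s t := by
  -- The products at `e` and at `b` add up to `dist e b`, so the one at `e` is at least `dist e b -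
  -- C`; only the base point then has to move to `o`. For `t` the same is done with `d`, which is
  -- finally replaced by `b`.
  have h1 : dist o b - 4 * L - C ≤ gromovProduct o s b := by
    have := gromovProduct_add_gromovProduct s e b
    have := gromovProduct_le_base e o s b
    have := dist_nonneg (x := b) (y := d)
    rw [gromovProduct_comm b s e] at *
    linarith [dist_triangle o e b, dist_comm e o]
  have h2 : dist o b - 4 * L - C ≤ gromovProduct o b t := by
    have := gromovProduct_add_gromovProduct t f d
    have := gromovProduct_le_base f o t d
    have := gromovProduct_le_move o t t d b
    rw [gromovProduct_comm d t f] at *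
    rw [gromovProduct_comm o b t]
    rw [dist_self] at *
    linarith [dist_triangle o f d, dist_comm f o, dist_triangle o d b, dist_comm d b]
  exact hδ.le_trans h1 h2

end Products

/-! ### Quasi-ruled paths -/

/-- A path along which the triangle inequality is an equality up to a bounded error. -/
def QuasiRuled {X : Type*} [MetricSpace X] (C : ℝ) (γ : ℝ → X) : Prop :=
  ∀ s t u : ℝ, s ≤ t → t ≤ u → gromovProduct (γ t) (γ s) (γ u) ≤ C

section QuasiRuled

variable {X : Type*} [MetricSpace X] {δ C : ℝ} {α β : ℝ → X}

theorem QuasiRuled.mono {C' : ℝ} (h : QuasiRuled C α) (hC : C ≤ C') : QuasiRuled C' α :=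
  fun s t u hst htu => (h s t u hst htu).trans hC

theorem QuasiRuled.smul {Γ : Type*} [Group Γ] [MulAction Γ X] [IsIsometricSMul Γ X]
    (h : QuasiRuled C α) (a : Γ) : QuasiRuled C (fun t => a • α t) := fun s t u hst htu => by
  rw [gromovProduct_smul_smul_smul]; exact h s t u hst htu

/-- A point from which the ends of a quasi-ruled path have small Gromov product is near it. -/
theorem QuasiRuled.exists_dist_le (hβ : QuasiRuled C β) (hδ : IsHyperbolicityConst X δ)
    (hc : Continuous β) {a b : ℝ} (hab : a ≤ b) {p : X} {D : ℝ}
    (hp : gromovProduct p (β a) (β b) ≤ D) :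
    ∃ t ∈ Set.Icc a b, dist p (β t) ≤ C + D + 2 * δ := by
  have hprod : ∀ q : X, Continuous fun t => gromovProduct p q (β t) := by
    intro q; unfold gromovProduct; fun_prop
  -- Connectedness of `[a, b]`: two closed sets cover it, one containing `b` and the other `a`, so
  -- they share a parameter `t`.
  have hcov : Set.Icc a b ⊆ {t | gromovProduct p (β a) (β t) ≤ D + δ} ∪
      {t | gromovProduct p (β b) (β t) ≤ D + δ} := by
    intro t _
    by_contra hcon
    simp only [Set.mem_union, Set.mem_ofPred_eq, not_or, not_le] at hcon
    rw [gromovProduct_comm p (β b)] at hcon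
    have := hδ.2 p (β a) (β t) (β b)
    have := lt_min hcon.1 hcon.2
    linarith
  obtain ⟨t, ht, h1, h2⟩ := isPreconnected_closed_iff.1 isPreconnected_Icc _ _
    (isClosed_le (hprod (β a)) continuous_const) (isClosed_le (hprod (β b)) continuous_const)
    hcov ⟨b, ⟨hab, le_rfl⟩, hp.trans (by linarith [hδ.1])⟩
    ⟨a, ⟨le_rfl, hab⟩, (gromovProduct_comm _ _ _).trans_le (hp.trans (by linarith [hδ.1]))⟩
  refine ⟨t, ht, ?_⟩
  simp only [Set.mem_ofPred_eq] at h1 h2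
  -- Seen from `β t`, both ends of the path now point towards `p` for a length of at least `dist p
  -- (β t) - (D + δ)`; being quasi-ruled forbids this unless `p` is near.
  have e1 := gromovProduct_add_gromovProduct (β a) p (β t)
  have e2 := gromovProduct_add_gromovProduct (β b) p (β t)
  have h3 : dist p (β t) - (D + δ) ≤ gromovProduct (β t) (β a) p := by linarith
  have h4 : dist p (β t) - (D + δ) ≤ gromovProduct (β t) p (β b) := by
    rw [gromovProduct_comm]; linarith
  linarith [hδ.le_trans h3 h4, hβ a t b ht.1 ht.2]

/-- From a point of one path, the ends of that path have product at most `C`, hence the nearby ends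
of the other have product at most `C + 2 * L`; `exists_dist_le` applies in both directions. -/
theorem QuasiRuled.hausdorffCloseRelEndpoints (hα : QuasiRuled C α) (hβ : QuasiRuled C β)
    (hδ : IsHyperbolicityConst X δ) (hαc : Continuous α) (hβc : Continuous β)
    {a b c d L : ℝ} (hab : a ≤ b) (hcd : c ≤ d) (hac : dist (α a) (β c) ≤ L)
    (hbd : dist (α b) (β d) ≤ L) :
    HausdorffCloseRelEndpoints (2 * C + 2 * L + 2 * δ) α a b β c d := by
  have hL : 0 ≤ L := dist_nonneg.trans hac
  have hC : 0 ≤ C := by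
    have := hα a a a le_rfl le_rfl
    simpa [gromovProduct] using this
  have hδ0 := hδ.1
  refine ⟨by linarith, by linarith,
    Metric.hausdorffDist_le_of_mem_dist (by linarith) ?_ ?_⟩
  · rintro _ ⟨t, ht, rfl⟩
    obtain ⟨s, hs, h⟩ := hβ.exists_dist_le hδ hβc hcd (p := α t) (D := C + 2 * L) (by
      linarith [hα a t b ht.1 ht.2, gromovProduct_le_move (α t) (β c) (α a) (β d) (α b),
        dist_comm (β c) (α a), dist_comm (β d) (α b)])
    exact ⟨β s, ⟨s, hs, rfl⟩, by linarith⟩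
  · rintro _ ⟨t, ht, rfl⟩
    obtain ⟨s, hs, h⟩ := hα.exists_dist_le hδ hαc hab (p := β t) (D := C + 2 * L) (by
      linarith [hβ c t d ht.1 ht.2, gromovProduct_le_move (β t) (α a) (β c) (α b) (β d)])
    exact ⟨α s, ⟨s, hs, rfl⟩, by linarith⟩

/-- Two quasi-ruled paths with nearby ends fellow travel, with a uniform constant. -/
theorem QuasiRuled.exists_fellow_traveler (hα : QuasiRuled C α) (hβ : QuasiRuled C β)
    (hδ : IsHyperbolicityConst X δ) (hαc : Continuous α) (hβc : Continuous β) {o : X}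
    {a b s₀ s₁ t₀ t₁ R : ℝ} (hab : a ≤ b) (hs₀ : s₀ ≤ a) (hs₁ : b ≤ s₁) (ht : t₀ ≤ t₁)
    (h₀ : R ≤ gromovProduct o (α s₀) (β t₀)) (h₁ : R ≤ gromovProduct o (α s₁) (β t₁))
    (ha : dist o (α a) + C + 2 * δ < R) (hb : dist o (α b) + C + 2 * δ < R) :
    ∃ c d : ℝ, c ≤ d ∧
      HausdorffCloseRelEndpoints (18 * C + 28 * δ) α a b β c d := by
  have hδ0 := hδ.1
  have hC : 0 ≤ C := by
    have := hα a a a le_rfl le_rfl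
    simpa [gromovProduct] using this
  have far₀ : ∀ p : X, dist o p + C + 2 * δ < R → C + 2 * δ < gromovProduct p (α s₀) (β t₀) :=
    fun p hp => by linarith [gromovProduct_le_base o p (α s₀) (β t₀)]
  have far₁ : ∀ p : X, dist o p + C + 2 * δ < R → C + 2 * δ < gromovProduct p (α s₁) (β t₁) :=
    fun p hp => by linarith [gromovProduct_le_base o p (α s₁) (β t₁)]
  -- From `α t` the ends of `α` have product at most `C`. Exchanging them one at a time for the ends
  -- of `β` costs `δ` each, and `exists_dist_le` then finds a point of `β`.
  have near : ∀ t ∈ Set.Icc a b, dist o (α t) + C + 2 * δ < R →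
      ∃ u ∈ Set.Icc t₀ t₁, dist (α t) (β u) ≤ 2 * C + 4 * δ := by
    intro t htab hto
    have e1 : gromovProduct (α t) (α s₁) (β t₀) ≤ C + δ := by
      refine hδ.le_of_lt (z := α s₀) ?_ ?_
      · rw [gromovProduct_comm]; exact hα _ _ _ (hs₀.trans htab.1) (htab.2.trans hs₁)
      · rw [gromovProduct_comm]; linarith [far₀ _ hto]
    have e2 : gromovProduct (α t) (β t₀) (β t₁) ≤ C + δ + δ := by
      refine hδ.le_of_lt (z := α s₁) ?_ ?_
      · rw [gromovProduct_comm]; exact e1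
      · rw [gromovProduct_comm]; linarith [far₁ _ hto]
    obtain ⟨u, hu, h⟩ := hβ.exists_dist_le hδ hβc ht e2
    exact ⟨u, hu, by linarith⟩
  obtain ⟨c, hc, hac⟩ := near a ⟨le_rfl, hab⟩ ha
  obtain ⟨d, hd, hbd⟩ := near b ⟨hab, le_rfl⟩ hb
  -- The parameters `c` and `d` may come in the wrong order. In that case `β c` and `β d` are shown
  -- to be close, so that `d' = c` works.
  suffices ∃ d' : ℝ, c ≤ d' ∧ dist (α b) (β d') ≤ 8 * C + 13 * δ by
    obtain ⟨d', hcd', hbd'⟩ := this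
    have := hα.hausdorffCloseRelEndpoints hβ hδ hαc hβc hab hcd' (L := 8 * C + 13 * δ)
      (by linarith) hbd'
    refine ⟨c, d', hcd', ?_⟩
    convert this using 1
    ring
  rcases le_total c d with hcd | hdc
  · exact ⟨d, hcd, by linarith⟩
  · refine ⟨c, le_rfl, ?_⟩
    -- Replacing `α a`, `α b` by `β c`, `β d` bounds the product of `β c` and `β t₁` at `β d`; the
    -- order `d ≤ c ≤ t₁` bounds that of `β d` and `β t₁` at `β c`. The two add up to `dist (β c) (β
    -- d)`.
    have e1 : gromovProduct (α b) (α a) (β t₁) ≤ C + δ := by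
      refine hδ.le_of_lt (z := α s₁) (hα _ _ _ hab hs₁) ?_
      rw [gromovProduct_comm]; linarith [far₁ _ hb]
    have e2 := gromovProduct_le_base (β d) (α b) (β c) (β t₁)
    have e3 := gromovProduct_le_move (α b) (β c) (α a) (β t₁) (β t₁)
    have e4 := hβ d c t₁ hdc hc.2
    have e5 := gromovProduct_add_gromovProduct (β t₁) (β c) (β d)
    rw [dist_self] at e3
    linarith [gromovProduct_comm (β c) (β d) (β t₁), gromovProduct_comm (β d) (β c) (β t₁),
      dist_triangle (α b) (β d) (β c), dist_comm (β c) (α a), dist_comm (β d) (α b),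
      dist_comm (β c) (β d)]

end QuasiRuled

/-! ### Quasi-axes -/

section QuasiAxes

theorem zpow_smul_of_translation {Γ X : Type*} [Group Γ] [MulAction Γ X] {g : Γ}
    {ℓ : ℝ → X} {T : ℝ} (h : ∀ t, g • ℓ t = ℓ (t + T)) (n : ℤ) (t : ℝ) : g ^ n • ℓ t = ℓ (t + n * T) := by
  have hinv : ∀ t, g⁻¹ • ℓ t = ℓ (t - T) := fun t => by
    rw [inv_smul_eq_iff, h, sub_add_cancel]
  induction n generalizing t with
  | zero => simp
  | succ i ih => rw [zpow_add_one, mul_smul, h, ih]; congr 1; push_cast; ring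
  | pred i ih => rw [zpow_sub_one, mul_smul, hinv, ih]; congr 1; push_cast; ring

theorem pow_smul_of_translation {Γ X : Type*} [Group Γ] [MulAction Γ X] {g : Γ} {ℓ : ℝ → X}
    {T : ℝ} (h : ∀ t, g • ℓ t = ℓ (t + T)) (n : ℕ) : g ^ n • ℓ 0 = ℓ (n * T) := by
  simpa using zpow_smul_of_translation h n 0

theorem inv_pow_smul_of_translation {Γ X : Type*} [Group Γ] [MulAction Γ X] {g : Γ}
    {ℓ : ℝ → X} {T : ℝ} (h : ∀ t, g • ℓ t = ℓ (t + T)) (n : ℕ) :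
    g⁻¹ ^ n • ℓ 0 = ℓ (-(n * T)) := by
  simpa using zpow_smul_of_translation h (-n) 0

variable {Γ X : Type*} [Group Γ] [MetricSpace X] [MulAction Γ X]

variable [IsIsometricSMul Γ X]

/-- The two halves of an orbit of a loxodromic element have bounded Gromov products. -/
theorem IsLoxodromic.exists_gromovProduct_orbit_le [IsGromovHyperbolic X] {g : Γ}
    (hg : IsLoxodromic X g) (x : X) :
    ∃ C : ℝ, ∀ m n : ℕ, gromovProduct x (g⁻¹ ^ m • x) (g ^ n • x) ≤ C := by
  by_contra! hcon
  obtain ⟨δ, hδ⟩ := exists_isHyperbolicityConst X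
  refine hg.repellingPoint_ne_attractingPoint ?_
  rw [IsLoxodromic.repellingPoint, hg.inv.attractingPoint_eq x, hg.attractingPoint_eq x,
    GromovBoundary.mk_eq_mk]
  refine GromovClose.of_base x (tendsto_atTop.2 fun r => ?_)
  obtain ⟨p, hp⟩ := eventually_atTop.1
    (tendsto_atTop.1 (hg.inv.gromovClose_orbit x x) (r + 2 * δ))
  obtain ⟨q, hq⟩ := eventually_atTop.1
    (tendsto_atTop.1 (hg.gromovClose_orbit x x) (r + 2 * δ))
  -- The sums dominate all displacements of the initial orbit points, so a product above them forces
  -- `m ≥ p.2` and `n ≥ q.1`. One large product then spreads to all late pairs, and the two ends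
  -- would coincide.
  obtain ⟨m, n, hmn⟩ := hcon (max (r + 2 * δ)
    ((∑ i ∈ Finset.range p.2, dist x (g⁻¹ ^ i • x)) +
      ∑ i ∈ Finset.range q.1, dist x (g ^ i • x)))
  obtain ⟨h1, h2⟩ := max_lt_iff.1 hmn
  have s1 : 0 ≤ ∑ i ∈ Finset.range p.2, dist x (g⁻¹ ^ i • x) :=
    Finset.sum_nonneg fun _ _ => dist_nonneg
  have s2 : 0 ≤ ∑ i ∈ Finset.range q.1, dist x (g ^ i • x) :=
    Finset.sum_nonneg fun _ _ => dist_nonneg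
  have hm : p.2 ≤ m := by
    by_contra! h
    have := Finset.single_le_sum (f := fun i => dist x (g⁻¹ ^ i • x))
      (fun _ _ => dist_nonneg) (Finset.mem_range.2 h)
    linarith [gromovProduct_le_dist_left x (g⁻¹ ^ m • x) (g ^ n • x)]
  have hn : q.1 ≤ n := by
    by_contra! h
    have := Finset.single_le_sum (f := fun i => dist x (g ^ i • x))
      (fun _ _ => dist_nonneg) (Finset.mem_range.2 h)
    linarith [gromovProduct_le_dist_right x (g⁻¹ ^ m • x) (g ^ n • x)]
  refine eventually_atTop.2 ⟨(p.1, q.2), fun w hw => ?_⟩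
  have e1 := hδ.le_trans (hp (w.1, m) ⟨hw.1, hm⟩) h1.le
  have e2 := hδ.le_trans e1 (y := g ^ n • x) (z := g ^ w.2 • x)
    (by linarith [hq (n, w.2) ⟨hn, hw.2⟩, hδ.1])
  linarith

/-- A quasi-axis of a loxodromic element is quasi-ruled. -/
theorem IsQuasiAxis.exists_quasiRuled [IsGromovHyperbolic X] {g : Γ} (hg : IsLoxodromic X g)
    {ℓ : ℝ → X} (hℓ : IsQuasiAxis g ℓ) : ∃ C : ℝ, QuasiRuled C ℓ := by
  obtain ⟨-, ⟨K, B, hK, hB, hQI⟩, T, hT, htr⟩ := hℓ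
  obtain ⟨C, hC⟩ := hg.exists_gromovProduct_orbit_le (ℓ 0)
  have near : ∀ t : ℝ, dist (ℓ t) (g ^ ⌊t / T⌋ • ℓ 0) ≤ K * T + B := by
    intro t
    rw [zpow_smul_of_translation htr, zero_add]
    refine (hQI _ _).2.trans ?_
    have h1 := Int.floor_le (t / T)
    have h2 := Int.lt_floor_add_one (t / T)
    rw [le_div_iff₀ hT] at h1
    rw [div_lt_iff₀ hT] at h2
    have : dist t (⌊t / T⌋ * T) ≤ T := by
      rw [Real.dist_eq, abs_le]; constructor <;> linarith
    nlinarith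
  -- Translating the middle orbit point to `ℓ 0` reduces this to the bound for the two half-orbits.
  have orb : ∀ i m j : ℤ, i ≤ m → m ≤ j →
      gromovProduct (g ^ m • ℓ 0) (g ^ i • ℓ 0) (g ^ j • ℓ 0) ≤ C := by
    intro i m j him hmj
    obtain ⟨a, ha⟩ := Int.eq_ofNat_of_zero_le (sub_nonneg.2 him)
    obtain ⟨b, hb⟩ := Int.eq_ofNat_of_zero_le (sub_nonneg.2 hmj)
    have hi : g ^ i • ℓ 0 = g ^ m • g⁻¹ ^ a • ℓ 0 := by
      rw [smul_smul, ← zpow_natCast, ← ha, inv_zpow', ← zpow_add]; congr 2; ring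
    have hj : g ^ j • ℓ 0 = g ^ m • g ^ b • ℓ 0 := by
      rw [smul_smul, ← zpow_natCast, ← hb, ← zpow_add]; congr 2; ring
    rw [hi, hj, gromovProduct_smul_smul_smul]
    exact hC a b
  refine ⟨C + 3 * (K * T + B), fun s t u hst htu => ?_⟩
  have h1 := gromovProduct_le_base (ℓ t) (g ^ ⌊t / T⌋ • ℓ 0) (ℓ s) (ℓ u)
  have h2 := gromovProduct_le_move (g ^ ⌊t / T⌋ • ℓ 0) (ℓ s) (g ^ ⌊s / T⌋ • ℓ 0) (ℓ u)
    (g ^ ⌊u / T⌋ • ℓ 0)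
  have h3 := orb ⌊s / T⌋ ⌊t / T⌋ ⌊u / T⌋ (Int.floor_le_floor (by gcongr))
    (Int.floor_le_floor (by gcongr))
  linarith [near s, near t, near u]

/-- Concatenate the translates by powers of `g` of a geodesic from `x` to `g • x`, each run in unit
time. The path stays at bounded distance from the orbit of `x`, which makes it a quasi-isometric
embedding. -/
theorem IsLoxodromic.exists_isQuasiAxis [IsGeodesicSpace X] {g : Γ} (hg : IsLoxodromic X g) :
    ∃ ℓ : ℝ → X, IsQuasiAxis g ℓ := by
  obtain ⟨x, K, C, hK, hC, h⟩ := hg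
  obtain ⟨γ, h0, h1, hγ⟩ := IsGeodesicSpace.exists_geodesic x (g • x)
  set D := dist x (g • x)
  have hD0 : 0 ≤ D := dist_nonneg
  have hfr : ∀ t : ℝ, Int.fract t * D ∈ Set.Icc 0 D := fun t =>
    ⟨mul_nonneg (Int.fract_nonneg t) hD0, mul_le_of_le_one_left hD0 (Int.fract_lt_one t).le⟩
  have hγc : ContinuousOn γ (Set.Icc 0 D) := by
    refine LipschitzOnWith.continuousOn (K := 1) (LipschitzOnWith.of_dist_le_mul ?_)
    intro s hs t ht
    rw [hγ s hs t ht, Real.dist_eq]; simp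
  refine ⟨fun t => g ^ ⌊t⌋ • γ (Int.fract t * D), ?_, ?_, 1, one_pos, ?_⟩
  · have hlf : LocallyFinite fun n : ℤ => Set.Icc (n : ℝ) (n + 1) := by
      intro x
      refine ⟨Set.Ioo (x - 1) (x + 1), Ioo_mem_nhds (by linarith) (by linarith),
        (Set.finite_Icc (⌊x⌋ - 2) (⌊x⌋ + 2)).subset ?_⟩
      rintro n ⟨t, ht, hxt⟩
      have h1 := Int.floor_le x
      have h2 := Int.lt_floor_add_one x
      have h3 : (n : ℝ) < (⌊x⌋ + 2 : ℤ) := by push_cast; linarith [ht.1, hxt.2]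
      have h4 : (⌊x⌋ - 2 : ℤ) < (n : ℝ) := by push_cast; linarith [ht.2, hxt.1]
      exact ⟨by exact_mod_cast h4.le, by exact_mod_cast h3.le⟩
    refine hlf.continuous (iUnion_Icc_intCast ℝ) (fun _ => isClosed_Icc) fun n => ?_
    have : ContinuousOn (fun t : ℝ => g ^ n • γ ((t - n) * D)) (Set.Icc (n : ℝ) (n + 1)) := by
      refine (continuous_const_smul (g ^ n)).comp_continuousOn (hγc.comp (by fun_prop) ?_)
      intro t ht
      exact ⟨mul_nonneg (by linarith [ht.1]) hD0, mul_le_of_le_one_left hD0 (by linarith [ht.2])⟩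
    refine this.congr fun t ht => ?_
    -- At the right end `n + 1` the floor jumps; continuity holds because consecutive pieces agree
    -- there, by `h0` and `h1`.
    rcases ht.2.eq_or_lt with rfl | hlt
    · simp only [Int.floor_add_one, Int.floor_intCast, Int.fract_add_one, Int.fract_intCast,
        zero_mul, add_sub_cancel_left, one_mul, h0, h1, zpow_add_one, mul_smul]
    · have : ⌊t⌋ = n := Int.floor_eq_iff.2 ⟨ht.1, hlt⟩
      simp only [this, Int.fract]
  · have near : ∀ t : ℝ, dist (g ^ ⌊t⌋ • γ (Int.fract t * D)) (g ^ ⌊t⌋ • x) ≤ D := by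
      intro t
      rw [dist_smul, ← h0, hγ _ (hfr t) _ ⟨le_rfl, hD0⟩, sub_zero, abs_of_nonneg (hfr t).1]
      exact (hfr t).2
    -- `2 * D` pays for passing to orbit points; the extra `K` pays for rounding the parameters,
    -- which changes their distance by at most `1`.
    refine ⟨K, C + 2 * D + K, hK, by positivity, fun s t => ?_⟩
    obtain ⟨hl, hu⟩ := h ⌊s⌋ ⌊t⌋
    have hst : |dist ⌊s⌋ ⌊t⌋ - dist s t| ≤ 1 := by
      rw [Int.dist_eq, Real.dist_eq]
      refine (abs_abs_sub_abs_le _ _).trans ?_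
      rw [abs_le]
      constructor <;> linarith [Int.floor_le s, Int.floor_le t, Int.lt_floor_add_one s,
        Int.lt_floor_add_one t]
    obtain ⟨hst1, hst2⟩ := abs_le.1 hst
    have ns := near s
    have nt := near t
    constructor
    · have e : dist s t / K ≤ dist ⌊s⌋ ⌊t⌋ / K + K := by
        have : (1 : ℝ) / K ≤ K := by rw [div_le_iff₀ (by linarith)]; nlinarith
        have : dist s t / K ≤ (dist ⌊s⌋ ⌊t⌋ + 1) / K := by gcongr; linarith
        rw [add_div] at this
        linarith
      linarith [dist_triangle4 (g ^ ⌊s⌋ • x) (g ^ ⌊s⌋ • γ (Int.fract s * D))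
        (g ^ ⌊t⌋ • γ (Int.fract t * D)) (g ^ ⌊t⌋ • x),
        dist_comm (g ^ ⌊s⌋ • x) (g ^ ⌊s⌋ • γ (Int.fract s * D))]
    · have e : K * dist ⌊s⌋ ⌊t⌋ ≤ K * dist s t + K := by nlinarith
      linarith [dist_triangle4 (g ^ ⌊s⌋ • γ (Int.fract s * D)) (g ^ ⌊s⌋ • x) (g ^ ⌊t⌋ • x)
        (g ^ ⌊t⌋ • γ (Int.fract t * D)),
        dist_comm (g ^ ⌊t⌋ • x) (g ^ ⌊t⌋ • γ (Int.fract t * D))]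
  · intro t
    simp only [Int.floor_add_one, Int.fract_add_one, smul_smul]
    rw [add_comm, zpow_add, zpow_one]

end QuasiAxes

/-! ### The topology of the Gromov boundary -/

namespace GromovBoundary

variable {X : Type*} [MetricSpace X] [IsGromovHyperbolic X]

theorem exists_mk (ξ : GromovBoundary X) : ∃ (u : ℕ → X) (hu : GromovClose u u), mk u hu = ξ := by
  obtain ⟨⟨u, hu⟩, h⟩ := Quotient.exists_rep ξ
  exact ⟨u, hu, h⟩

theorem mem_basicNhd_mk {o : X} {r : ℝ} {u v : ℕ → X} (hu : GromovClose u u)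
    (hv : GromovClose v v)
    (h : ∀ᶠ p : ℕ × ℕ in atTop, r ≤ gromovProduct o (u p.1) (v p.2)) :
    mk v hv ∈ basicNhd o r (mk u hu) :=
  ⟨u, v, hu, hv, rfl, rfl, h⟩

theorem self_mem_basicNhd (o : X) (r : ℝ) (ξ : GromovBoundary X) : ξ ∈ basicNhd o r ξ := by
  obtain ⟨u, hu, rfl⟩ := exists_mk ξ
  exact mem_basicNhd_mk hu hu (tendsto_atTop.1 (hu o) r)

/-- Changing the representatives costs at most `2δ`. -/
theorem eventually_of_mem_basicNhd {δ : ℝ} (hδ : IsHyperbolicityConst X δ) {o : X} {r : ℝ}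
    {u v : ℕ → X} {hu : GromovClose u u} {hv : GromovClose v v}
    (h : mk v hv ∈ basicNhd o r (mk u hu)) :
    ∀ᶠ p : ℕ × ℕ in atTop, r - 2 * δ ≤ gromovProduct o (u p.1) (v p.2) := by
  obtain ⟨u', v', hu', hv', h1, h2, h3⟩ := h
  obtain ⟨a, ha⟩ := eventually_atTop.1 (tendsto_atTop.1 ((mk_eq_mk.1 h1).symm o) r)
  obtain ⟨b, hb⟩ := eventually_atTop.1 (tendsto_atTop.1 (mk_eq_mk.1 h2 o) r)
  obtain ⟨c, hc⟩ := eventually_atTop.1 h3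
  refine eventually_atTop.2 ⟨(a.1, b.2), fun p hp => ?_⟩
  have e1 := ha (p.1, max a.2 c.1) ⟨hp.1, le_max_left _ _⟩
  have e2 := hc (max a.2 c.1, max b.1 c.2) ⟨le_max_right _ _, le_max_right _ _⟩
  have e3 := hb (max b.1 c.2, p.2) ⟨le_max_left _ _, hp.2⟩
  have e4 := hδ.le_trans e1 e2
  have e5 := hδ.le_trans e4 (by linarith [hδ.1] : r - δ ≤ _)
  linarith

/-- Of the loss `3 * δ`, `2 * δ` comes from changing representatives and `δ` from hyperbolicity. -/
theorem basicNhd_subset_basicNhd {δ : ℝ} (hδ : IsHyperbolicityConst X δ) {o : X} {r : ℝ}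
    {ξ η : GromovBoundary X} (h : η ∈ basicNhd o (r + 3 * δ) ξ) :
    basicNhd o (r + 3 * δ) η ⊆ basicNhd o r ξ := by
  intro ζ hζ
  obtain ⟨u, hu, rfl⟩ := exists_mk ξ
  obtain ⟨v, hv, rfl⟩ := exists_mk η
  obtain ⟨w, hw, rfl⟩ := exists_mk ζ
  obtain ⟨a, ha⟩ := eventually_atTop.1 (eventually_of_mem_basicNhd hδ h)
  obtain ⟨b, hb⟩ := eventually_atTop.1 (eventually_of_mem_basicNhd hδ hζ)
  refine mem_basicNhd_mk hu hw (eventually_atTop.2 ⟨(a.1, b.2), fun p hp => ?_⟩)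
  have e1 := ha (p.1, max a.2 b.1) ⟨hp.1, le_max_left _ _⟩
  have e2 := hb (max a.2 b.1, p.2) ⟨le_max_right _ _, hp.2⟩
  linarith [hδ.le_trans e1 e2]

theorem basicNhd_base (o o' : X) (r : ℝ) (ξ : GromovBoundary X) :
    basicNhd o' (r + dist o o') ξ ⊆ basicNhd o r ξ := by
  rintro η ⟨u, v, hu, hv, h1, h2, h3⟩
  refine ⟨u, v, hu, hv, h1, h2, h3.mono fun p hp => ?_⟩
  linarith [gromovProduct_base o o' (u p.1) (v p.2)]

/-- Basic neighbourhoods are not known to be open. The set of points having some basic neighbourhood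
inside the given one is open by `basicNhd_subset_basicNhd`, and it lies between `ξ` and that
neighbourhood. -/
theorem basicNhd_mem_nhds (o : X) (r : ℝ) (ξ : GromovBoundary X) : basicNhd o r ξ ∈ 𝓝 ξ := by
  obtain ⟨δ, hδ⟩ := exists_isHyperbolicityConst X
  have hopen : IsOpen {η | ∃ s : ℝ, basicNhd o s η ⊆ basicNhd o r ξ} := by
    rintro η ⟨s, hs⟩ o'
    exact ⟨s + 3 * δ + dist o o', fun ζ hζ =>
      ⟨s + 3 * δ, (basicNhd_subset_basicNhd hδ (basicNhd_base o o' _ η hζ)).trans hs⟩⟩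
  refine mem_of_superset (hopen.mem_nhds ⟨r, subset_rfl⟩) ?_
  rintro η ⟨s, hs⟩
  exact hs (self_mem_basicNhd o s η)

theorem exists_basicNhd_subset (o : X) {ξ : GromovBoundary X} {U : Set (GromovBoundary X)}
    (hU : U ∈ 𝓝 ξ) : ∃ r : ℝ, basicNhd o r ξ ⊆ U := by
  obtain ⟨V, hVU, hV, hξ⟩ := mem_nhds_iff.1 hU
  obtain ⟨r, hr⟩ := hV ξ hξ o
  exact ⟨r, hr.trans hVU⟩

/-- A point lying in every basic neighbourhood of `η` has representatives with products to those of
`η` tending to infinity, so it equals `η`. -/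
instance : T1Space (GromovBoundary X) := by
  refine ⟨fun ξ => ⟨fun η hη o => ?_⟩⟩
  obtain ⟨δ, hδ⟩ := exists_isHyperbolicityConst X
  by_contra! hcon
  refine hη ?_
  obtain ⟨u, hu, rfl⟩ := exists_mk ξ
  obtain ⟨v, hv, rfl⟩ := exists_mk η
  refine mk_eq_mk.2 (GromovClose.of_base o (tendsto_atTop.2 fun r => ?_))
  obtain ⟨ζ, h1, h2⟩ := Set.not_subset.1 (hcon (r + 2 * δ))
  obtain rfl : ζ = mk u hu := by simpa using h2
  simpa using eventually_of_mem_basicNhd hδ h1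

variable {Γ : Type*} [Group Γ] [MulAction Γ X] [IsIsometricSMul Γ X]

theorem smul_mem_basicNhd (a : Γ) {o : X} {r : ℝ} {ξ η : GromovBoundary X}
    (h : η ∈ basicNhd o r ξ) : a • η ∈ basicNhd (a • o) r (a • ξ) := by
  obtain ⟨u, v, hu, hv, rfl, rfl, h3⟩ := h
  refine mem_basicNhd_mk (hu.smul a) (hv.smul a) (h3.mono fun p hp => ?_)
  rwa [gromovProduct_smul_smul_smul]

instance : ContinuousConstSMul Γ (GromovBoundary X) where
  continuous_const_smul a := by
    refine ⟨fun U hU ξ hξ o => ?_⟩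
    obtain ⟨r, hr⟩ := hU (a • ξ) hξ (a • o)
    exact ⟨r, fun η hη => hr (smul_mem_basicNhd a hη)⟩

end GromovBoundary

/-! ### The topology on pairs of distinct boundary points -/

namespace BoundaryPair

open GromovBoundary

variable {X : Type*} [MetricSpace X] [IsGromovHyperbolic X]

theorem mem_closure_iff (o : X) {p : BoundaryPair X} {S : Set (BoundaryPair X)} :
    p ∈ closure S ↔ ∀ r : ℝ, ∃ q ∈ S, q.1.1 ∈ basicNhd o r p.1.1 ∧
      q.1.2 ∈ basicNhd o r p.1.2 := by
  rw [mem_closure_iff_nhds]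
  constructor
  · intro h r
    obtain ⟨q, ⟨h1, h2⟩, hq⟩ := h
      ((fun q : BoundaryPair X => q.1.1) ⁻¹' basicNhd o r p.1.1 ∩
        (fun q : BoundaryPair X => q.1.2) ⁻¹' basicNhd o r p.1.2)
      (inter_mem
        ((continuous_fst.comp continuous_subtype_val).continuousAt (basicNhd_mem_nhds o r p.1.1))
        ((continuous_snd.comp continuous_subtype_val).continuousAt (basicNhd_mem_nhds o r p.1.2)))
    exact ⟨q, hq, h1, h2⟩
  · intro h W hW
    obtain ⟨V, hV, hVW⟩ := mem_nhds_subtype _ _ _ |>.1 hW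
    obtain ⟨U₁, hU₁, U₂, hU₂, hU⟩ := mem_nhds_prod_iff.1 hV
    obtain ⟨r₁, hr₁⟩ := exists_basicNhd_subset o hU₁
    obtain ⟨r₂, hr₂⟩ := exists_basicNhd_subset o hU₂
    obtain ⟨q, hq, h1, h2⟩ := h (max r₁ r₂)
    exact ⟨q, hVW (hU ⟨hr₁ (basicNhd_anti o (le_max_left _ _) _ h1),
      hr₂ (basicNhd_anti o (le_max_right _ _) _ h2)⟩), hq⟩

instance {Γ : Type*} [Group Γ] [MulAction Γ X] [IsIsometricSMul Γ X] :
    ContinuousConstSMul Γ (BoundaryPair X) where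
  continuous_const_smul a := by
    refine Continuous.subtype_mk (Continuous.prodMk ?_ ?_) _
    · exact (continuous_fst.comp continuous_subtype_val).const_smul a
    · exact (continuous_snd.comp continuous_subtype_val).const_smul a

end BoundaryPair

/-! ### Orbit closures in topological spaces -/

section Orbits

variable {G Y : Type*} [Group G] [MulAction G Y] [TopologicalSpace Y]

theorem closure_orbit_subset_closure_orbit [ContinuousConstSMul G Y] {y z : Y}
    (h : y ∈ closure (MulAction.orbit G z)) :
    closure (MulAction.orbit G y) ⊆ closure (MulAction.orbit G z) := by
  refine closure_minimal ?_ isClosed_closure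
  rintro _ ⟨a, rfl⟩
  refine map_mem_closure (continuous_const_smul a) h ?_
  rintro _ ⟨b, rfl⟩
  exact ⟨a * b, mul_smul a b z⟩

/-- An open `U` isolating `y` in its orbit meets the orbit of `z` in some `q`. As `q` is in `U` and
in the closure of the orbit of `y`, it is in the closure of `{y}`, so `q = y` and the orbits meet.
-/
theorem orbit_eq_orbit_of_isDiscrete [T1Space Y] {y z : Y}
    (hy : IsDiscrete (MulAction.orbit G y))
    (h : closure (MulAction.orbit G y) = closure (MulAction.orbit G z)) :
    MulAction.orbit G y = MulAction.orbit G z := by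
  obtain ⟨U, hU, hUy⟩ := isDiscrete_iff_forall_mem_exists_isOpen.1 hy y
    (MulAction.mem_orbit_self y)
  have hyU : y ∈ U := (hUy.symm.subset rfl).1
  obtain ⟨q, hqU, hq⟩ := mem_closure_iff.1
    (h ▸ subset_closure (MulAction.mem_orbit_self y)) U hU hyU
  have hq' : q ∈ closure (U ∩ MulAction.orbit G y) :=
    hU.inter_closure ⟨hqU, h ▸ subset_closure hq⟩
  rw [hUy, closure_singleton] at hq'
  obtain rfl : q = y := hq'
  exact MulAction.orbit_eq_iff.2 hq

end Orbits

/-! ### The Bestvina–Fujiwara relation and closures of orbits -/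

section Main

open GromovBoundary

variable {Γ X : Type*} [Group Γ] [MetricSpace X] [MulAction Γ X] [IsIsometricSMul Γ X]
  [IsGromovHyperbolic X]

/-- A translate of the axis of `h` passes near `α (-n)`, `α 0` and `α n`, so from `α 0` its ends
point in the directions of the ends of `α` up to a distance growing with `n`. Only the closeness of
endpoints is used. -/
theorem BestvinaFujiwaraEquiv.endpointPair_mem_closure {g h : Γ}
    (hgh : BestvinaFujiwaraEquiv X g h) (hg : IsLoxodromic X g) (hh : IsLoxodromic X h) :
    hg.endpointPair ∈ closure (MulAction.orbit Γ hh.endpointPair) := by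
  rcases hgh with rfl | ⟨-, -, α, ℓ, hα, hℓ, L, hL⟩
  · exact subset_closure (MulAction.mem_orbit_self _)
  obtain ⟨δ, hδ⟩ := exists_isHyperbolicityConst X
  obtain ⟨C₁, hC₁⟩ := hα.exists_quasiRuled hg
  obtain ⟨C₂, hC₂⟩ := hℓ.exists_quasiRuled hh
  obtain ⟨-, ⟨K, B, hK, hB, hQI⟩, T, hT, htr⟩ := hα
  obtain ⟨hℓc, -, S, hS, htrS⟩ := hℓ
  obtain ⟨C, hαC, hℓC⟩ : ∃ C, QuasiRuled C α ∧ QuasiRuled C ℓ :=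
    ⟨max C₁ C₂, hC₁.mono (le_max_left _ _), hC₂.mono (le_max_right _ _)⟩
  have hC : 0 ≤ C := by simpa [gromovProduct] using hαC 0 0 0 le_rfl le_rfl
  have hδ0 := hδ.1
  set M := 2 * C + 2 * L + 2 * δ with hM
  refine (BoundaryPair.mem_closure_iff (α 0)).2 fun r => ?_
  -- Chosen so that `n / K - B` is at least `r` plus the loss `4 * M + C + δ` in
  -- `le_gromovProduct_of_close`.
  set n : ℝ := K * (max r 0 + 4 * M + C + δ + B) with hn
  have hL0 : 0 ≤ L := by
    obtain ⟨c, d, k, -, h, -⟩ := hL 0 0 le_rfl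
    exact dist_nonneg.trans h
  have hn0 : 0 ≤ n := by positivity
  have hfar : ∀ s : ℝ, |s| = n → r + 4 * M + C + δ ≤ dist (α 0) (α s) := by
    intro s hs
    have := (hQI 0 s).1
    rw [Real.dist_eq, zero_sub, abs_neg, hs, hn, mul_div_cancel_left₀ _ (by linarith)] at this
    linarith [le_max_left r 0]
  obtain ⟨c, d, k, hcd, hc, hd, -⟩ := hL (-n) n (by linarith)
  have hβ := hℓC.smul k⁻¹
  have hc' : dist (α (-n)) (k⁻¹ • ℓ c) ≤ L := by
    rwa [← dist_smul k, smul_inv_smul]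
  have hd' : dist (α n) (k⁻¹ • ℓ d) ≤ L := by
    rwa [← dist_smul k, smul_inv_smul]
  -- The parameter `e`, where the translate passes within `M` of `α 0`, is the common start of its
  -- two rays, through `c` and through `d`.
  obtain ⟨e, ⟨hce, hed⟩, he⟩ := hβ.exists_dist_le hδ (hℓc.const_smul k⁻¹) hcd (p := α 0)
    (D := C + 2 * L) (by
      linarith [gromovProduct_le_move (α 0) (k⁻¹ • ℓ c) (α (-n)) (k⁻¹ • ℓ d) (α n),
        hαC (-n) 0 n (by linarith) hn0, dist_comm (α (-n)) (k⁻¹ • ℓ c),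
        dist_comm (α n) (k⁻¹ • ℓ d)])
  have hsource : dist (α 0) (α 0) ≤ M := by rw [dist_self]; positivity
  refine ⟨k⁻¹ • hh.endpointPair, MulAction.mem_orbit _ _, ?_, ?_⟩
  · change k⁻¹ • hh.repellingPoint ∈ basicNhd _ r hg.repellingPoint
    rw [IsLoxodromic.repellingPoint, IsLoxodromic.repellingPoint, hg.inv.attractingPoint_eq (α 0),
      hh.inv.attractingPoint_eq (ℓ 0), smul_mk]
    refine mem_basicNhd_mk _ _ ?_
    simp only [inv_pow_smul_of_translation htr, inv_pow_smul_of_translation htrS]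
    obtain ⟨i, hi⟩ := exists_nat_gt (n / T)
    obtain ⟨j, hj⟩ := exists_nat_gt (-c / S)
    refine eventually_atTop.2 ⟨(i, j), fun p hp => ?_⟩
    rw [div_lt_iff₀ hT] at hi
    rw [div_lt_iff₀ hS] at hj
    have hp1 : (i : ℝ) * T ≤ p.1 * T := by gcongr; exact hp.1
    have hp2 : (j : ℝ) * S ≤ p.2 * S := by gcongr; exact hp.2
    have h1 := hαC (-(p.1 * T)) (-n) 0 (by linarith) (by linarith)
    have h2 := hβ (-(p.2 * S)) c e (by linarith) hce
    rw [gromovProduct_comm] at h1 h2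
    have := hδ.le_gromovProduct_of_close (L := M) h1 h2 hsource (by linarith) (by linarith)
    linarith [hfar (-n) (by rw [abs_neg, abs_of_nonneg hn0])]
  · change k⁻¹ • hh.attractingPoint ∈ basicNhd _ r hg.attractingPoint
    rw [hg.attractingPoint_eq (α 0), hh.attractingPoint_eq (ℓ 0), smul_mk]
    refine mem_basicNhd_mk _ _ ?_
    simp only [pow_smul_of_translation htr, pow_smul_of_translation htrS]
    obtain ⟨i, hi⟩ := exists_nat_gt (n / T)
    obtain ⟨j, hj⟩ := exists_nat_gt (d / S)
    refine eventually_atTop.2 ⟨(i, j), fun p hp => ?_⟩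
    rw [div_lt_iff₀ hT] at hi
    rw [div_lt_iff₀ hS] at hj
    have hp1 : (i : ℝ) * T ≤ p.1 * T := by gcongr; exact hp.1
    have hp2 : (j : ℝ) * S ≤ p.2 * S := by gcongr; exact hp.2
    have := hδ.le_gromovProduct_of_close (L := M) (hαC 0 n (p.1 * T) hn0 (by linarith))
      (hβ e d (p.2 * S) hed (by linarith)) hsource (by linarith) (by linarith)
    linarith [hfar n (abs_of_nonneg hn0)]

/-- If the closures of the orbits of `∂± g` and `∂± h` meet, then translates of the orbits of
`g` and `h` have ends that are as close as desired, and stay at bounded distance from `o`. -/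
theorem IsLoxodromic.exists_translates_close {g h : Γ} (hg : IsLoxodromic X g)
    (hh : IsLoxodromic X h) (hmeet : (closure (MulAction.orbit Γ hg.endpointPair) ∩
      closure (MulAction.orbit Γ hh.endpointPair)).Nonempty) (o x y : X) :
    ∃ P : ℝ, ∀ r : ℝ, ∃ a b : Γ, ∀ᶠ i : ℕ in atTop,
      r ≤ gromovProduct o (a • g⁻¹ ^ i • x) (b • h⁻¹ ^ i • y) ∧
      r ≤ gromovProduct o (a • g ^ i • x) (b • h ^ i • y) ∧
      gromovProduct o (a • g⁻¹ ^ i • x) (a • g ^ i • x) ≤ P := by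
  obtain ⟨δ, hδ⟩ := exists_isHyperbolicityConst X
  have hδ0 := hδ.1
  obtain ⟨⟨⟨ξ, η⟩, hne⟩, hpg, hph⟩ := hmeet
  obtain ⟨u, hu, rfl⟩ := exists_mk ξ
  obtain ⟨v, hv, rfl⟩ := exists_mk η
  -- This is where `ξ ≠ η` enters. A frequent bound suffices, since a single late pair `(m, l)`
  -- serves as reference below.
  obtain ⟨P, hP⟩ : ∃ P : ℝ, ∃ᶠ p : ℕ × ℕ in atTop, gromovProduct o (u p.1) (v p.2) < P := by
    by_contra! hcon
    refine hne (mk_eq_mk.2 (GromovClose.of_base o (tendsto_atTop.2 fun r => ?_)))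
    simpa using hcon r
  refine ⟨P + 2 * δ, fun r => ?_⟩
  obtain ⟨_, ⟨a, rfl⟩, ha₁, ha₂⟩ := (BoundaryPair.mem_closure_iff o).1 hpg
    (max (r + δ) (P + 2 * δ) + 2 * δ)
  obtain ⟨_, ⟨b, rfl⟩, hb₁, hb₂⟩ := (BoundaryPair.mem_closure_iff o).1 hph
    (max (r + δ) (P + 2 * δ) + 2 * δ)
  change a • hg.repellingPoint ∈ _ at ha₁
  change a • hg.attractingPoint ∈ _ at ha₂
  change b • hh.repellingPoint ∈ _ at hb₁
  change b • hh.attractingPoint ∈ _ at hb₂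
  rw [IsLoxodromic.repellingPoint, hg.inv.attractingPoint_eq x, smul_mk] at ha₁
  rw [IsLoxodromic.repellingPoint, hh.inv.attractingPoint_eq y, smul_mk] at hb₁
  rw [hg.attractingPoint_eq x, smul_mk] at ha₂
  rw [hh.attractingPoint_eq y, smul_mk] at hb₂
  obtain ⟨A₁, hA₁⟩ := eventually_atTop.1 (eventually_of_mem_basicNhd hδ ha₁)
  obtain ⟨A₂, hA₂⟩ := eventually_atTop.1 (eventually_of_mem_basicNhd hδ ha₂)
  obtain ⟨B₁, hB₁⟩ := eventually_atTop.1 (eventually_of_mem_basicNhd hδ hb₁)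
  obtain ⟨B₂, hB₂⟩ := eventually_atTop.1 (eventually_of_mem_basicNhd hδ hb₂)
  obtain ⟨⟨m, l⟩, ⟨hm, hl⟩, hml⟩ := frequently_atTop.1 hP (max A₁.1 B₁.1, max A₂.1 B₂.1)
  obtain ⟨hm₁, hm₂⟩ := max_le_iff.1 hm
  obtain ⟨hl₁, hl₂⟩ := max_le_iff.1 hl
  refine ⟨a, b, ?_⟩
  filter_upwards [eventually_ge_atTop A₁.2, eventually_ge_atTop A₂.2,
    eventually_ge_atTop B₁.2, eventually_ge_atTop B₂.2] with i h1 h2 h3 h4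
  have e1 := hA₁ (m, i) ⟨hm₁, h1⟩
  have e2 := hA₂ (l, i) ⟨hl₁, h2⟩
  have e3 := hB₁ (m, i) ⟨hm₂, h3⟩
  have e4 := hB₂ (l, i) ⟨hl₂, h4⟩
  simp only [add_sub_cancel_right] at e1 e2 e3 e4 hml
  have hr := le_max_left (r + δ) (P + 2 * δ)
  have hP' := le_max_right (r + δ) (P + 2 * δ)
  refine ⟨?_, ?_, ?_⟩
  · rw [gromovProduct_comm] at e1
    have := hδ.le_trans e1 e3
    linarith
  · rw [gromovProduct_comm] at e2
    have := hδ.le_trans e2 e4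
    linarith
  -- Otherwise the chain from `u m` through the two orbit points to `v l` gives a product of at
  -- least `P`.
  · by_contra! hcon
    have f1 := hδ.le_trans (hP'.trans e1) hcon.le
    have f2 := hδ.le_trans f1 (y := a • g ^ i • x) (z := v l)
      (by rw [gromovProduct_comm]; linarith)
    linarith

/-- Only the translating elements depend on `a` and `b`: a longer segment requires closer agreement
of the ends, while the bound `P` and the fellow-travelling constant stay fixed. -/
theorem bestvinaFujiwaraEquiv_of_nonempty [IsGeodesicSpace X] {g h : Γ} (hg : IsLoxodromic X g)
    (hh : IsLoxodromic X h) (hmeet : (closure (MulAction.orbit Γ hg.endpointPair) ∩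
      closure (MulAction.orbit Γ hh.endpointPair)).Nonempty) :
    BestvinaFujiwaraEquiv X g h := by
  obtain ⟨α, hα⟩ := hg.exists_isQuasiAxis
  obtain ⟨β, hβ⟩ := hh.exists_isQuasiAxis
  refine Or.inr ⟨hg, hh, α, β, hα, hβ, ?_⟩
  obtain ⟨δ, hδ⟩ := exists_isHyperbolicityConst X
  have hδ0 := hδ.1
  obtain ⟨C₁, hC₁⟩ := hα.exists_quasiRuled hg
  obtain ⟨C₂, hC₂⟩ := hβ.exists_quasiRuled hh
  obtain ⟨hαc, ⟨K, B, hK, hB, hQI⟩, T, hT, htr⟩ := hα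
  obtain ⟨hβc, -, S, hS, htrS⟩ := hβ
  obtain ⟨C, hαC, hβC⟩ : ∃ C, QuasiRuled C α ∧ QuasiRuled C β :=
    ⟨max C₁ C₂, hC₁.mono (le_max_left _ _), hC₂.mono (le_max_right _ _)⟩
  obtain ⟨P, hP⟩ := hg.exists_translates_close hh hmeet (α 0) (α 0) (β 0)
  refine ⟨18 * C + 28 * δ, fun a b hab => ?_⟩
  -- Bounds the distance from `α 0` to the shifted segment: the first terms reach `k • α t₀`, the
  -- last covers a parameter change of at most `T + (b - a)`.
  set Q := C + P + 2 * δ + (K * (T + (b - a)) + B)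
  obtain ⟨k, l, hkl⟩ := hP (Q + C + 2 * δ + 1)
  simp only [inv_pow_smul_of_translation htr, inv_pow_smul_of_translation htrS,
    pow_smul_of_translation htr, pow_smul_of_translation htrS] at hkl
  obtain ⟨t₀, ht₀⟩ : ∃ t₀ : ℝ, dist (α 0) (k • α t₀) ≤ C + P + 2 * δ := by
    obtain ⟨i, -, -, hi⟩ := hkl.exists
    have : 0 ≤ (i : ℝ) * T := by positivity
    obtain ⟨t, -, ht⟩ := (hαC.smul k).exists_dist_le hδ (hαc.const_smul k)
      (by linarith : -((i : ℝ) * T) ≤ i * T) hi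
    exact ⟨t, ht⟩
  -- The shift by `g ^ m` moves the parameter `a` to within one period before `t₀`.
  set m : ℤ := ⌊(t₀ - a) / T⌋
  have hm1 : m * T ≤ t₀ - a := (le_div_iff₀ hT).1 (Int.floor_le _)
  have hm2 : t₀ - a < (m + 1) * T := (div_lt_iff₀ hT).1 (Int.lt_floor_add_one _)
  -- `i` is so large that `±i * T`, shifted back by `m * T`, enclose `[a, b]`.
  obtain ⟨i, ⟨h₀, h₁, -⟩, hi⟩ := (hkl.and (eventually_ge_atTop
    ⌈(|a| + |b| + |m * T|) / T⌉₊)).exists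
  have hi' : |a| + |b| + |m * T| ≤ i * T := (div_le_iff₀ hT).1 (Nat.ceil_le.1 hi)
  have hz : ∀ t : ℝ, g ^ m • α t = α (t + m * T) := zpow_smul_of_translation htr m
  have hnear : ∀ t : ℝ, a ≤ t → t ≤ b → dist (α 0) (k • α (t + m * T)) ≤ Q := by
    intro t hat htb
    have h1 : dist (α t₀) (α (t + m * T)) ≤ K * (T + (b - a)) + B := by
      refine (hQI _ _).2.trans ?_
      have : dist t₀ (t + m * T) ≤ T + (b - a) := by
        rw [Real.dist_eq, abs_le]; constructor <;> linarith
      gcongr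
    have h2 := dist_triangle (α 0) (k • α t₀) (k • α (t + m * T))
    rw [dist_smul] at h2
    linarith
  have hbase : ∀ p : X, dist (l⁻¹ • α 0) (l⁻¹ • p) = dist (α 0) p := fun p => dist_smul _ _ _
  -- Everything is moved by `l⁻¹`, so that `β` itself is followed and only `α` is translated.
  have hprod : ∀ s t : ℝ, gromovProduct (l⁻¹ • α 0) ((l⁻¹ * k * g ^ m) • α (s - m * T)) (β t) =
      gromovProduct (α 0) (k • α s) (l • β t) := by
    intro s t
    rw [← gromovProduct_smul_smul_smul l, smul_inv_smul, mul_smul, mul_smul, hz, sub_add_cancel,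
      smul_inv_smul]
  have iT : 0 ≤ (i : ℝ) * T := by positivity
  have iS : 0 ≤ (i : ℝ) * S := by positivity
  obtain ⟨c, d, hcd, hclose⟩ := (hαC.smul (l⁻¹ * k * g ^ m)).exists_fellow_traveler hβC hδ
    (hαc.const_smul _) hβc (o := l⁻¹ • α 0) (a := a) (b := b) (s₀ := -(i * T) - m * T)
    (s₁ := i * T - m * T) (t₀ := -(i * S)) (t₁ := i * S) (R := Q + C + 2 * δ + 1) hab
    (by linarith [neg_abs_le a, abs_nonneg b, neg_abs_le (m * T)])
    (by linarith [le_abs_self b, abs_nonneg a, le_abs_self (m * T)]) (by linarith)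
    (by rwa [hprod]) (by rwa [hprod])
    (by rw [mul_smul, mul_smul, hz, hbase]; linarith [hnear a le_rfl hab])
    (by rw [mul_smul, mul_smul, hz, hbase]; linarith [hnear b hab le_rfl])
  exact ⟨c, d, _, hcd, hclose⟩

end Main

theorem mainTheorem5 {Γ X : Type*} [Group Γ] [MetricSpace X] [IsGeodesicSpace X]
    [IsGromovHyperbolic X] [MulAction Γ X] [IsIsometricSMul Γ X] (g h : Γ)
    (hg : IsLoxodromic X g) (hh : IsLoxodromic X h) :
    [BestvinaFujiwaraEquiv X g h,
      closure (MulAction.orbit Γ hg.endpointPair) = closure (MulAction.orbit Γ hh.endpointPair),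
      (closure (MulAction.orbit Γ hg.endpointPair) ∩
        closure (MulAction.orbit Γ hh.endpointPair)).Nonempty].TFAE ∧
    (IsWWPD X g →
      [BestvinaFujiwaraEquiv X g h,
        closure (MulAction.orbit Γ hg.endpointPair) = closure (MulAction.orbit Γ hh.endpointPair),
        (closure (MulAction.orbit Γ hg.endpointPair) ∩
          closure (MulAction.orbit Γ hh.endpointPair)).Nonempty,
        MulAction.orbit Γ hg.endpointPair = MulAction.orbit Γ hh.endpointPair].TFAE) := by
  have h12 : BestvinaFujiwaraEquiv X g h → closure (MulAction.orbit Γ hg.endpointPair) =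
      closure (MulAction.orbit Γ hh.endpointPair) := by
    intro hgh
    have hmem := hgh.endpointPair_mem_closure hg hh
    -- The definition of `∼` is not visibly symmetric; symmetry comes from the closures having `∂±
    -- g` in common.
    have hhg : BestvinaFujiwaraEquiv X h g := bestvinaFujiwaraEquiv_of_nonempty hh hg
      ⟨_, hmem, subset_closure (MulAction.mem_orbit_self _)⟩
    exact (closure_orbit_subset_closure_orbit hmem).antisymm
      (closure_orbit_subset_closure_orbit (hhg.endpointPair_mem_closure hh hg))
  have h23 : closure (MulAction.orbit Γ hg.endpointPair) =
      closure (MulAction.orbit Γ hh.endpointPair) →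
      (closure (MulAction.orbit Γ hg.endpointPair) ∩
        closure (MulAction.orbit Γ hh.endpointPair)).Nonempty := fun heq =>
    ⟨_, subset_closure (MulAction.mem_orbit_self _),
      heq ▸ subset_closure (MulAction.mem_orbit_self _)⟩
  have h31 := bestvinaFujiwaraEquiv_of_nonempty hg hh
  refine ⟨?_, ?_⟩
  · tfae_have 1 → 2 := h12
    tfae_have 2 → 3 := h23
    tfae_have 3 → 1 := h31
    tfae_finish
  · rintro ⟨_, hdisc⟩
    tfae_have 1 → 2 := h12
    tfae_have 2 → 3 := h23
    tfae_have 3 → 1 := h31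
    tfae_have 2 → 4 := orbit_eq_orbit_of_isDiscrete hdisc
    tfae_have 4 → 2 := fun heq => by rw [heq]
    tfae_finish
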